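/- Let $n\ge 2$ and let $\overrightarrow{C_n}$ be the directed cycle, with vertices $v_1,\dots,v_n$ and edge set $E=\{(v_i,v_{i+1}) : 1\le i<n\}\cup\{(v_n,v_1)\}$ (so $|E|=n$). A proper coloring is a map $\kappa:\{v_1,\dots,v_n\}\to\{1,2,3,\dots\}$ with $\kappa(u)\ne\kappa(v)$ for every $(u,v)\in E$; let $\mathrm{asc}(\kappa)$ be the number of edges $(u,v)\in E$ with $\kappa(u)<\kappa(v)$, and let $$X_{\overrightarrow{C_n}}(\mathbf x,t)=\sum_{\kappa\text{ proper}} t^{\mathrm{asc}(\kappa)}\,x_{\kappa(v_1)}x_{\kappa(v_2)}\cdots x_{\kappa(v_n)}$$ be the chromatic quasisymmetric function of $\overrightarrow{C_n}$, a formal power series in $\mathbf x=(x_1,x_2,\dots)$ with coefficients in $\mathbb Q[t]$. Let $e_k=e_k(\mathbf x)$ be the elementary symmetric functions, $e_\lambda=\prod_i e_{\lambda_i}$ for a partition $\lambda$, and $[k]_t=1+t+\cdots+t^{k-1}$ (so $[0]_t=0$). Then $$X_{\overrightarrow{C_n}}(\mathbf x,t)=\sum_{\lambda\vdash n}e_\lambda(\mathbf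 x)\sum_{\mu:\,\lambda(\mu)=\lambda}\mu_1\; t[\mu_1-1]_t\; t[\mu_2-1]_t\cdots t[\mu_{l(\lambda)}-1]_t ,$$ where $\mu=(\mu_1,\mu_2,\dots,\mu_{l(\lambda)})$ runs over the compositions of $n$ whose parts, written in decreasing order, form $\lambda$, and $l(\lambda)$ is the number of parts of $\lambda$. Consequently $X_{\overrightarrow{C_n}}(\mathbf x,t)$ is a palindromic, $e$-positive and $e$-unimodal polynomial in $t$. That is, $X_{\overrightarrow{C_n}}(\mathbf x,t)=\sum_{j=0}^{n}a_j(\mathbf x)t^j$, where $a_j=a_{n-j}$ for $0\le j\le n$, every $a_j$ is $e$-positive, and $a_{j+1}-a_j$ is $e$-positive for every integer $j$ with $0\le j\le\frac{n-1}{2}$. Here a symmetric function that is homogeneous of degree $n$ is called $e$-positive if its expansion in the basis $\{e_\lambda:\lambda\vdash n\}$ has nonnegative coefficients. -/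

import Mathlib

namespace ChromaticQSym

/-- The directed cycle on the vertices `v₁, …, vₙ` (here `0, …, n - 1`): its edges are
`(vᵢ, vᵢ₊₁)` for `1 ≤ i < n`, together with `(vₙ, v₁)`. It is loopless for `n ≥ 2`. -/
def directedCycle (n : ℕ) : Digraph (Fin n) where
  Adj i j := (i : ℕ) + 1 = (j : ℕ) ∨ ((i : ℕ) + 1 = n ∧ (j : ℕ) = 0)

section Digraph

variable {V : Type*} (G : Digraph V)

/-- The number of directed edges. -/
noncomputable def numEdges : ℕ := Set.ncard {p : V × V | G.Adj p.1 p.2}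

/-- A proper coloring of a (loopless) digraph by positive integers: a proper coloring of the
underlying undirected graph. -/
def IsProper (κ : V → ℕ+) : Prop := ∀ u v, G.Adj u v → κ u ≠ κ v

/-- The number of ascents of a coloring: directed edges `(u, v)` with `κ u < κ v`. -/
noncomputable def asc (κ : V → ℕ+) : ℕ :=
  Set.ncard {p : V × V | G.Adj p.1 p.2 ∧ κ p.1 < κ p.2}

/-- The exponent vector of the monomial `x_κ = ∏ v, x_{κ v}`. -/
noncomputable def content [Fintype V] (κ : V → ℕ+) : ℕ+ →₀ ℕ := ∑ v, Finsupp.single (κ v) 1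

/-- Only finitely many proper colorings `κ` have a given monomial `x_κ`. -/
theorem finite_properColorings [Fintype V] (d : ℕ+ →₀ ℕ) :
    {κ : V → ℕ+ | IsProper G κ ∧ content κ = d}.Finite := by
  classical
  refine (Set.Finite.pi' (fun _ : V => d.support.finite_toSet)).subset ?_
  rintro κ ⟨-, rfl⟩ v
  simp only [Finset.mem_coe, Finsupp.mem_support_iff, content, Finsupp.finsetSum_apply]
  intro h
  have := Finset.sum_eq_zero_iff.mp h v (Finset.mem_univ v)
  simp at this

/-- The chromatic quasisymmetric function `X_G(x, t) = ∑_κ t ^ asc κ * x_κ`, the sum being over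
all proper colorings `κ : V → ℕ+`. It is a formal power series in `x₁, x₂, …` with coefficients
in `ℚ[t]`: the coefficient of the monomial `x ^ d` is the sum of `t ^ asc κ` over the finitely
many proper colorings `κ` with `x_κ = x ^ d`. -/
noncomputable def chromaticQSym [Fintype V] : MvPowerSeries ℕ+ (Polynomial ℚ) :=
  fun d => ∑ κ ∈ (finite_properColorings G d).toFinset, (Polynomial.X : Polynomial ℚ) ^ asc G κ

end Digraph

section Symmetric

open Classical in
/-- The elementary symmetric function `e_k` in the variables `x₁, x₂, …`: the sum of all
squarefree monomials of degree `k`. -/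
noncomputable def esymm (R : Type*) [CommSemiring R] (k : ℕ) : MvPowerSeries ℕ+ R :=
  fun d => if d.degree = k ∧ ∀ i, d i ≤ 1 then 1 else 0

/-- `e_p = ∏ e_{p_i}` for an integer partition `p` with parts `p_i`. -/
noncomputable def esymmPart (R : Type*) [CommSemiring R] {n : ℕ} (p : n.Partition) :
    MvPowerSeries ℕ+ R :=
  (p.parts.map (esymm R)).prod

/-- A power series `f` (over `ℚ`) is an `e`-positive symmetric function of degree `n`: it is a
linear combination of the `e_p`, for `p` a partition of `n`, with nonnegative coefficients. -/
def IsEPositive (n : ℕ) (f : MvPowerSeries ℕ+ ℚ) : Prop :=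
  ∃ c : n.Partition → ℚ, (∀ p, 0 ≤ c p) ∧ f = ∑ p, c p • esymmPart ℚ p

end Symmetric

section InT

/-- The coefficient `a_j(x)` of `t ^ j` in a power series `F(x, t)` with coefficients in
`ℚ[t]`. -/
noncomputable def tCoeff (F : MvPowerSeries ℕ+ (Polynomial ℚ)) (j : ℕ) : MvPowerSeries ℕ+ ℚ :=
  fun d => (MvPowerSeries.coeff d F).coeff j

/-- `F(x, t) = ∑_{j = 0}^{m} a_j(x) t ^ j` with `a_j = a_{m - j}` for all `0 ≤ j ≤ m`. -/
def IsPalindromic (m : ℕ) (F : MvPowerSeries ℕ+ (Polynomial ℚ)) : Prop :=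
  (∀ j, m < j → tCoeff F j = 0) ∧ ∀ j, j ≤ m → tCoeff F j = tCoeff F (m - j)

/-- Every coefficient `a_j(x)` of `F(x, t) = ∑_j a_j(x) t ^ j` is `e`-positive of degree `n`. -/
def IsEPositiveInT (n : ℕ) (F : MvPowerSeries ℕ+ (Polynomial ℚ)) : Prop :=
  ∀ j, IsEPositive n (tCoeff F j)

/-- `e`-unimodality of `F(x, t) = ∑_{j = 0}^{m} a_j(x) t ^ j` (palindromic, of degree `n` in `x`):
`a_{j + 1} - a_j` is `e`-positive whenever `j ≤ (m - 1) / 2`. -/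
def IsEUnimodal (n m : ℕ) (F : MvPowerSeries ℕ+ (Polynomial ℚ)) : Prop :=
  ∀ j : ℕ, (j : ℚ) ≤ ((m : ℚ) - 1) / 2 → IsEPositive n (tCoeff F (j + 1) - tCoeff F j)

/-- The `t`-integer `[k]_t = 1 + t + ⋯ + t ^ (k - 1)`. -/
noncomputable def tInt (k : ℕ) : Polynomial ℚ := ∑ i ∈ Finset.range k, Polynomial.X ^ i

/-- The weight `μ₁ · t[μ₁ - 1]_t · t[μ₂ - 1]_t ⋯ t[μ_l - 1]_t` of a composition
`μ = (μ₁, …, μ_l)` (of a positive integer). -/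
noncomputable def weight {n : ℕ} (μ : Composition n) : Polynomial ℚ :=
  (μ.blocks.headD 0 : Polynomial ℚ) * (μ.blocks.map fun k => Polynomial.X * tInt (k - 1)).prod

end InT

end ChromaticQSym

/-! Colorings of the cycle are closed walks among the colors. With finitely many colors, let `M` be
the transfer matrix whose entry at `(i, j)` is `t x_j`, `x_j` or `0` for `i < j`, `i > j`, `i = j`;
the trace of `M ^ n` is then the truncated chromatic function (`coeff_chromaticQSym_directedCycle`).
A rank-one perturbation gives `(t - 1) det (1 - z M) = t E(z) - E(t z)` with `E(z) = ∏ (1 + z x_i)`,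
so the coefficient of `z ^ k`, for `k ≥ 1`, is `-t [k - 1]_t e_k`.

Newton's identities, from the logarithmic derivative of the determinant, become a recurrence in `n`
(`chromaticQSym_directedCycle_succ`). Its solution is a sum over compositions
(`Composition.eq_sum_of_newton`), which is the `e`-expansion.

Each factor `t [k - 1]_t` is symmetric about `k / 2`, and multiplying by it preserves symmetric
unimodality (`IsSymmUnimodal.mul_tInt`). Hence every weight is symmetric unimodal about `n / 2`, and
so are the coefficients of the `e_λ`. -/

open Finset

/-! ### Jacobi's formula -/

namespace Derivation

/-- The Leibniz rule for finite products. -/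
theorem leibniz_finset_prod {R A ι : Type*} [CommSemiring R] [CommSemiring A] [Algebra R A]
    [DecidableEq ι] (D : Derivation R A A) (s : Finset ι) (f : ι → A) :
    D (∏ i ∈ s, f i) = ∑ i ∈ s, (∏ j ∈ s.erase i, f j) * D (f i) := by
  induction s using Finset.induction_on with
  | empty => simp
  | insert a s ha ih =>
    rw [prod_insert ha, D.leibniz, ih, sum_insert ha, erase_insert ha, add_comm]
    simp only [smul_eq_mul, mul_sum]
    congr 1
    refine sum_congr rfl fun i hi => ?_
    have hia : a ≠ i := fun h => ha (h ▸ hi)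
    rw [erase_insert_of_ne hia, prod_insert (fun h => ha (mem_of_mem_erase h)), mul_assoc]

/-- **Jacobi's formula** for the derivative of a determinant. -/
theorem map_det_eq_trace {R A ι : Type*} [CommRing R] [CommRing A] [Algebra R A]
    [Fintype ι] [DecidableEq ι] (D : Derivation R A A) (B : Matrix ι ι A) :
    D B.det = (B.adjugate * B.map D).trace := by
  -- Cramer's rule: each diagonal entry is the determinant with one column differentiated.
  have h1 : (B.adjugate * B.map D).trace
      = ∑ i, (B.updateCol i fun k => D (B k i)).det := by
    refine sum_congr rfl fun i _ => ?_
    rw [← Matrix.cramer_apply, Matrix.cramer_eq_adjugate_mulVec]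
    rfl
  rw [h1]
  simp only [Matrix.det_apply]
  rw [sum_comm, map_sum]
  refine sum_congr rfl fun σ _ => ?_
  rw [← smul_sum, Units.smul_def, Units.smul_def, map_zsmul, leibniz_finset_prod]
  congr 1
  refine sum_congr rfl fun i _ => ?_
  rw [← mul_prod_erase univ _ (mem_univ i), Matrix.updateCol_self, mul_comm]
  congr 1
  refine prod_congr rfl fun j hj => ?_
  rw [Matrix.updateCol_ne (ne_of_mem_erase hj)]

end Derivation

/-! ### Newton's identities and closed walks -/

namespace Matrix

variable {ι R : Type*} [Fintype ι] [DecidableEq ι] [CommRing R]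

/-- The determinant of `1 - z M` as a power series in `z`. -/
noncomputable def detOneSub (M : Matrix ι ι R) : PowerSeries R :=
  (1 - (PowerSeries.X : PowerSeries R) • M.map PowerSeries.C).det

theorem constantCoeff_detOneSub (M : Matrix ι ι R) :
    PowerSeries.constantCoeff M.detOneSub = 1 := by
  rw [detOneSub, RingHom.map_det]
  convert Matrix.det_one (n := ι) (R := R)
  ext i j
  by_cases h : i = j <;> simp [Matrix.one_apply, h]

/-- The logarithmic derivative of `det (1 - z M)` generates the traces of the powers of `M`. -/
theorem derivative_detOneSub (M : Matrix ι ι R) :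
    PowerSeries.derivative R M.detOneSub
      = -(M.detOneSub * PowerSeries.mk fun n => (M ^ (n + 1)).trace) := by
  set B : Matrix ι ι (PowerSeries R) :=
    1 - (PowerSeries.X : PowerSeries R) • M.map PowerSeries.C with hB
  -- The geometric series `∑ zⁿ Mⁿ`, inverse to `1 - z M`.
  set G : Matrix ι ι (PowerSeries R) :=
    Matrix.of fun i j => PowerSeries.mk fun n => (M ^ n) i j with hG
  have hMG : M.map PowerSeries.C * G
      = Matrix.of fun i j => PowerSeries.mk fun n => (M ^ (n + 1)) i j := by
    ext i j n
    simp [hG, Matrix.mul_apply, pow_succ', PowerSeries.coeff_C_mul]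
  have hBG : B * G = 1 := by
    rw [hB, Matrix.sub_mul, Matrix.smul_mul, hMG, Matrix.one_mul]
    ext i j n
    rcases n with _ | n
    · by_cases h : i = j <;> simp [hG, h, Matrix.one_apply]
    · by_cases h : i = j <;> simp [hG, h, Matrix.one_apply, PowerSeries.coeff_succ_X_mul,
        PowerSeries.coeff_one]
  have hadj : B.adjugate = B.det • G := by
    rw [← Matrix.mul_one B.adjugate, ← hBG, ← Matrix.mul_assoc, Matrix.adjugate_mul,
      Matrix.smul_mul, Matrix.one_mul]
  have hDB : B.map (PowerSeries.derivative R) = -M.map PowerSeries.C := by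
    ext1 i j
    by_cases h : i = j <;> simp [hB, h, Derivation.leibniz]
  have htr : (PowerSeries.mk fun n => (M ^ (n + 1)).trace) = (M.map PowerSeries.C * G).trace := by
    rw [hMG]
    ext n
    simp [Matrix.trace]
  change PowerSeries.derivative R B.det = -(B.det * _)
  rw [Derivation.map_det_eq_trace, hadj, hDB, htr, Matrix.mul_neg, Matrix.trace_neg,
    Matrix.smul_mul, Matrix.trace_smul, Matrix.trace_mul_comm, smul_eq_mul]

/-- **Newton's identities** for the coefficients of `det (1 - z M)`. -/
theorem newton_detOneSub (M : Matrix ι ι R) (m : ℕ) :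
    (M ^ (m + 1)).trace = -(PowerSeries.coeff (m + 1) M.detOneSub * (m + 1))
      - ∑ k ∈ range m, PowerSeries.coeff (k + 1) M.detOneSub * (M ^ (m - k)).trace := by
  have h := congrArg (PowerSeries.coeff m) (derivative_detOneSub M)
  rw [PowerSeries.coeff_derivative, map_neg, PowerSeries.coeff_mul,
    Finset.Nat.sum_antidiagonal_eq_sum_range_succ_mk, sum_range_succ'] at h
  simp only [PowerSeries.coeff_mk, PowerSeries.coeff_zero_eq_constantCoeff,
    constantCoeff_detOneSub, one_mul, Nat.sub_zero] at h
  have h2 : ∑ k ∈ range m, PowerSeries.coeff (k + 1) M.detOneSub * (M ^ (m - (k + 1) + 1)).trace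
      = ∑ k ∈ range m, PowerSeries.coeff (k + 1) M.detOneSub * (M ^ (m - k)).trace := by
    refine sum_congr rfl fun k hk => ?_
    have := mem_range.mp hk
    rw [show m - (k + 1) + 1 = m - k by omega]
  rw [h2] at h
  rw [h]
  ring

/-- The entries of a power of a matrix as sums over walks. -/
theorem pow_succ_apply_eq_sum (M : Matrix ι ι R) (m : ℕ) (i j : ι) :
    (M ^ (m + 1)) i j = ∑ κ : Fin (m + 1) → ι,
      if κ 0 = i then (∏ l : Fin m, M (κ l.castSucc) (κ l.succ)) * M (κ (Fin.last m)) j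
      else 0 := by
  induction m generalizing i with
  | zero =>
    rw [← (Equiv.funUnique (Fin 1) ι).symm.sum_comp]
    simp
  | succ m ih =>
    rw [pow_succ', Matrix.mul_apply, ← (Fin.consEquiv fun _ : Fin (m + 2) => ι).sum_comp,
      Fintype.sum_prod_type]
    refine Eq.trans ?_ (sum_eq_single_of_mem i (mem_univ i) ?_).symm
    · simp only [ih, mul_sum, Fin.consEquiv_apply, Fin.cons_zero, if_true]
      rw [sum_comm]
      refine sum_congr rfl fun κ _ => ?_
      simp only [mul_ite, mul_zero, sum_ite_eq, mem_univ, if_true]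
      rw [Fin.prod_univ_succ, ← Fin.succ_last, Fin.cons_succ]
      simp [mul_assoc]
    · intro x _ hx
      exact sum_eq_zero fun κ _ => by simp [hx]

/-- The trace of a power of a matrix as a sum over closed walks. -/
theorem trace_pow_succ_eq_sum (M : Matrix ι ι R) (m : ℕ) :
    (M ^ (m + 1)).trace = ∑ κ : Fin (m + 1) → ι, ∏ l, M (κ l) (κ (l + 1)) := by
  simp only [Matrix.trace, Matrix.diag_apply, pow_succ_apply_eq_sum]
  rw [sum_comm]
  refine sum_congr rfl fun κ _ => ?_
  rw [Fintype.sum_ite_eq, Fin.prod_univ_castSucc, Fin.last_add_one]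
  simp [Fin.coeSucc_eq_succ]

end Matrix

/-! ### The determinant of the transfer matrix -/

namespace ChromaticQSym

section FiniteFamily

variable {ι R : Type*} [Fintype ι] [CommRing R]

/-- The elementary symmetric polynomial of degree `k` in a finite family `x`. -/
def finEsymm (x : ι → R) (k : ℕ) : R := ∑ T ∈ powersetCard k univ, ∏ i ∈ T, x i

theorem coeff_prod_one_add (x : ι → R) (k : ℕ) :
    PowerSeries.coeff k (∏ i, (1 + PowerSeries.X * PowerSeries.C (x i))) = finEsymm x k := by
  rw [prod_one_add, map_sum, finEsymm, powersetCard_eq_filter, sum_filter]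
  refine sum_congr rfl fun T _ => ?_
  rw [prod_mul_distrib, prod_const, ← map_prod, mul_comm, PowerSeries.coeff_C_mul,
    PowerSeries.coeff_X_pow]
  simp [eq_comm]

theorem finEsymm_mul (t : R) (x : ι → R) (k : ℕ) :
    finEsymm (fun i => t * x i) k = t ^ k * finEsymm x k := by
  rw [finEsymm, finEsymm, mul_sum]
  refine sum_congr rfl fun T hT => ?_
  rw [prod_mul_distrib, prod_const, (mem_powersetCard.mp hT).2]

end FiniteFamily

variable {ι R : Type*} [Fintype ι] [LinearOrder ι] [CommRing R]

/-- The transfer matrix of colorings weighted by ascents: its `(i, j)` entry is `t x_j`, `x_j` or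
`0` according to whether `i < j`, `i > j` or `i = j`. -/
def transferMatrix (t : R) (x : ι → R) : Matrix ι ι R :=
  Matrix.of fun i j => (if i < j then t else if j < i then 1 else 0) * x j

/-- Adding `s z x_j` to every entry of column `j` is a rank-one change, so the determinant becomes
`det B * (1 + s w)`, affine in `s`. At `s = 1` the entries below the diagonal cancel, at `s = t`
those above it; both determinants are then products of diagonal entries, and eliminating `w` gives
the identity. -/
theorem sub_one_mul_detOneSub_transferMatrix (t : R) (x : ι → R) :
    (PowerSeries.C t - 1) * (transferMatrix t x).detOneSub
      = PowerSeries.C t * ∏ i, (1 + PowerSeries.X * PowerSeries.C (x i))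
        - ∏ i, (1 + PowerSeries.X * PowerSeries.C (t * x i)) := by
  set B : Matrix ι ι (PowerSeries R) :=
    1 - (PowerSeries.X : PowerSeries R) • (transferMatrix t x).map PowerSeries.C with hB
  have hu : IsUnit B.det := by
    rw [PowerSeries.isUnit_iff_constantCoeff]
    exact (Matrix.constantCoeff_detOneSub (transferMatrix t x)).symm ▸ isUnit_one
  set v : ι → PowerSeries R := fun j => PowerSeries.X * PowerSeries.C (x j) with hv
  obtain ⟨w, hw⟩ : ∃ w, ∀ s : PowerSeries R,
      (B + Matrix.replicateCol Unit (fun _ => s) * Matrix.replicateRow Unit v).det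
        = B.det * (1 + s * w) := by
    refine ⟨(Matrix.replicateRow Unit v * B⁻¹ * Matrix.replicateCol Unit (fun _ : ι => (1 : PowerSeries R)) :
      Matrix Unit Unit (PowerSeries R)) () (), ?_⟩
    intro s
    rw [Matrix.det_add_replicateCol_mul_replicateRow hu]
    congr 1
    rw [Matrix.det_unique, Matrix.add_apply, Matrix.one_apply_eq,
      show Matrix.replicateCol Unit (fun _ : ι => s)
        = s • Matrix.replicateCol Unit (fun _ : ι => (1 : PowerSeries R)) by ext; simp,
      Matrix.mul_smul, Matrix.smul_apply, smul_eq_mul]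
  have e (s : PowerSeries R) (i j : ι) :
      (B + Matrix.replicateCol Unit (fun _ => s) * Matrix.replicateRow Unit v :
        Matrix ι ι (PowerSeries R)) i j
        = (if i = j then 1 else 0)
          + (s - PowerSeries.C (if i < j then t else if j < i then 1 else 0)) * v j := by
    simp [hB, hv, transferMatrix, Matrix.mul_apply, Matrix.one_apply]
    split_ifs <;> simp <;> ring
  have h1 := hw 1
  have ht := hw (PowerSeries.C t)
  rw [Matrix.det_of_isUpperTriangular] at h1
  · rw [Matrix.det_of_isLowerTriangular] at ht
    · simp only [e, lt_irrefl, if_true, if_false, map_zero, sub_zero, one_mul] at h1 ht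
      have e2 : ∏ i, (1 + PowerSeries.X * PowerSeries.C (t * x i))
          = ∏ i, (1 + PowerSeries.C t * v i) :=
        prod_congr rfl fun i _ => by rw [hv, map_mul]; ring
      change (PowerSeries.C t - 1) * B.det = _
      rw [e2, ht, h1]
      ring
    · intro i j hij
      have hij : i < j := hij
      rw [e, if_neg hij.ne, if_pos hij]
      simp
  · intro i j hij
    have hij : j < i := hij
    rw [e, if_neg hij.ne', if_neg hij.not_gt, if_pos hij]
    simp

/-- Comparing coefficients yields the factor `t - t ^ (k + 1) = -(t - 1) t [k]_t`, from which `t -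
1` is cancelled. -/
theorem coeff_detOneSub_transferMatrix {t : R} (ht : IsLeftRegular (t - 1)) (x : ι → R) (k : ℕ) :
    PowerSeries.coeff (k + 1) (transferMatrix t x).detOneSub
      = -(t * (∑ i ∈ range k, t ^ i) * finEsymm x (k + 1)) := by
  have h := congrArg (PowerSeries.coeff (k + 1)) (sub_one_mul_detOneSub_transferMatrix t x)
  rw [sub_mul, one_mul, map_sub, PowerSeries.coeff_C_mul, map_sub, PowerSeries.coeff_C_mul,
    coeff_prod_one_add, coeff_prod_one_add, finEsymm_mul] at h
  have hg := mul_geom_sum t k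
  apply ht
  dsimp only
  linear_combination h + t * finEsymm x (k + 1) * hg

end ChromaticQSym

/-! ### Solving the recurrence by compositions -/

namespace Composition

/-- Sums over the compositions of `m + 1` can be split according to the first block. -/
theorem sum_succ_eq_sum_cons {A : Type*} [AddCommMonoid A] (f : List ℕ → A) (m : ℕ) :
    ∑ μ : Composition (m + 1), f μ.blocks
      = ∑ k ∈ range (m + 1), ∑ ν : Composition (m - k), f ((k + 1) :: ν.blocks) := by
  rw [Finset.sum_sigma']
  symm
  refine sum_bij (fun x hx => ⟨(x.1 + 1) :: x.2.blocks, ?_, ?_⟩) (fun _ _ => mem_univ _) ?_ ?_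
    fun _ _ => rfl
  · rintro i hi
    rcases List.mem_cons.mp hi with rfl | h
    · omega
    · exact x.2.blocks_pos h
  · have := mem_range.mp (mem_sigma.mp hx).1
    rw [List.sum_cons, x.2.blocks_sum]
    omega
  · rintro ⟨k, ν⟩ _ ⟨k', ν'⟩ _ h
    obtain ⟨h1, h2⟩ := List.cons_eq_cons.mp (congrArg Composition.blocks h)
    obtain rfl : k = k' := Nat.succ_injective h1
    obtain rfl : ν = ν' := Composition.ext h2
    rfl
  · rintro ⟨_ | ⟨b, l⟩, hpos, hsum⟩ _
    · simp at hsum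
    · have hb : 0 < b := hpos List.mem_cons_self
      rw [List.sum_cons] at hsum
      refine ⟨⟨b - 1, ⟨l, fun h => hpos (List.mem_cons_of_mem _ h), by omega⟩⟩, ?_, ?_⟩
      · simp only [mem_sigma, mem_range, mem_univ, and_true]
        omega
      · ext1
        simp [Nat.sub_add_cancel hb]

/-- The solution of a Newton-type recurrence as a sum over compositions. -/
theorem eq_sum_of_newton {A : Type*} [CommSemiring A] (c P : ℕ → A)
    (hP : ∀ m, P (m + 1) = (m + 1 : ℕ) * c (m + 1) + ∑ k ∈ range m, c (k + 1) * P (m - k)) (m : ℕ) :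
    P (m + 1) = ∑ μ : Composition (m + 1), (μ.blocks.headD 0 : A) * (μ.blocks.map c).prod := by
  -- The recurrence peels off the first block, which leaves the last block unchanged unless it is
  -- the only one; so the induction marks the last block, and reversal moves the mark to the front.
  suffices h : ∀ m, P (m + 1) = ∑ μ : Composition (m + 1),
      (μ.blocks.getLastD 0 : A) * (μ.blocks.map c).prod by
    rw [h]
    refine Fintype.sum_bijective _ reverse_bijective _ _ fun μ => ?_
    rw [reverse_blocks, List.map_reverse, List.prod_reverse]
    congr 2
    simp [List.headD_eq_head?_getD, List.getLastD_eq_getLast?]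
  intro m
  induction m using Nat.strong_induction_on with
  | _ m ih =>
    rw [sum_succ_eq_sum_cons (fun l => ((l.getLastD 0 : ℕ) : A) * (l.map c).prod), sum_range_succ,
      hP, add_comm]
    congr 1
    · refine sum_congr rfl fun k hk => ?_
      obtain ⟨r, hr⟩ : ∃ r, m - k = r + 1 := ⟨m - k - 1, by have := mem_range.mp hk; omega⟩
      rw [hr, ih r (by omega), mul_sum]
      refine sum_congr rfl fun ν _ => ?_
      have hne : ν.blocks ≠ [] := by
        rw [Ne, blocks_eq_nil]
        omega
      obtain ⟨b, l, hbl⟩ := List.exists_cons_of_ne_nil hne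
      simp only [hbl, List.map_cons, List.prod_cons, List.getLastD_cons]
      ring
    · have hnil (ν : Composition 0) : ν.blocks = [] := (blocks_eq_nil ν).mpr rfl
      rw [Nat.sub_self, Fintype.sum_eq_single (default : Composition 0)
        fun x hx => (hx (Composition.ext ((hnil x).trans (hnil _).symm))).elim]
      simp [hnil]

end Composition

/-! ### From colorings to traces -/

namespace ChromaticQSym

/-- Addition in `Fin (m + 1)` wraps around, which supplies the closing edge. For `m = 0` this is a
loop, without proper colorings, consistent with `t [0]_t = 0` at the start of the recurrence. -/
theorem directedCycle_adj {m : ℕ} (i j : Fin (m + 1)) :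
    (directedCycle (m + 1)).Adj i j ↔ j = i + 1 := by
  rw [Fin.ext_iff, Fin.val_add_one]
  simp only [directedCycle]
  have := i.isLt
  have := j.isLt
  split_ifs with h
  · simp [h]
    omega
  · rw [Fin.ext_iff, Fin.val_last] at h
    omega

theorem ncard_directedCycle {m : ℕ} (Q : Fin (m + 1) → Fin (m + 1) → Prop)
    [DecidablePred fun l => Q l (l + 1)] :
    Set.ncard {p : Fin (m + 1) × Fin (m + 1) | (directedCycle (m + 1)).Adj p.1 p.2 ∧ Q p.1 p.2}
      = #{l : Fin (m + 1) | Q l (l + 1)} := by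
  have h : {p : Fin (m + 1) × Fin (m + 1) | (directedCycle (m + 1)).Adj p.1 p.2 ∧ Q p.1 p.2}
      = (fun l : Fin (m + 1) => (l, l + 1)) '' ({l : Fin (m + 1) | Q l (l + 1)} : Finset _) := by
    ext ⟨i, j⟩
    simp only [directedCycle_adj, Set.mem_ofPred_eq, Set.mem_image, mem_coe, mem_filter, mem_univ,
      true_and, Prod.mk.injEq]
    constructor
    · rintro ⟨rfl, h⟩
      exact ⟨i, h, rfl, rfl⟩
    · rintro ⟨_, h, rfl, rfl⟩
      exact ⟨rfl, h⟩
  rw [h, Set.ncard_image_of_injective _ fun a b hab => (Prod.ext_iff.mp hab).1,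
    Set.ncard_coe_finset]

theorem numEdges_directedCycle (m : ℕ) : numEdges (directedCycle (m + 1)) = m + 1 := by
  simpa [numEdges] using ncard_directedCycle (m := m) fun _ _ => True

theorem asc_directedCycle {m : ℕ} (κ : Fin (m + 1) → ℕ+) :
    asc (directedCycle (m + 1)) κ = #{l | κ l < κ (l + 1)} :=
  ncard_directedCycle fun i j => κ i < κ j

theorem isProper_directedCycle {m : ℕ} (κ : Fin (m + 1) → ℕ+) :
    IsProper (directedCycle (m + 1)) κ ↔ ∀ l, κ l ≠ κ (l + 1) := by
  simp [IsProper, directedCycle_adj]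

open Classical in
/-- The product of the ascent weights along a coloring of the cycle. -/
theorem prod_ascent_weight {m : ℕ} (κ : Fin (m + 1) → ℕ+) :
    (∏ l, if κ l < κ (l + 1) then (Polynomial.X : Polynomial ℚ)
        else if κ (l + 1) < κ l then 1 else 0)
      = if IsProper (directedCycle (m + 1)) κ then
          Polynomial.X ^ asc (directedCycle (m + 1)) κ else 0 := by
  split_ifs with h
  · rw [isProper_directedCycle] at h
    rw [asc_directedCycle, ← prod_const, prod_filter]
    refine prod_congr rfl fun l _ => ?_
    split_ifs with h1 h2
    · rfl
    · rfl
    · exact absurd (le_antisymm (not_lt.mp h2) (not_lt.mp h1)) (h l)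
  · rw [isProper_directedCycle] at h
    push Not at h
    obtain ⟨l, hl⟩ := h
    exact prod_eq_zero (mem_univ l) (by simp [hl])

theorem prod_X_eq_monomial {R V : Type*} [CommSemiring R] (s : Finset V) (κ : V → ℕ+) :
    ∏ v ∈ s, (MvPowerSeries.X (κ v) : MvPowerSeries ℕ+ R)
      = MvPowerSeries.monomial (∑ v ∈ s, Finsupp.single (κ v) 1) 1 := by
  classical
  induction s using Finset.induction_on with
  | empty => simp
  | insert a s ha ih =>
    rw [prod_insert ha, sum_insert ha, ih, MvPowerSeries.X, MvPowerSeries.monomial_mul_monomial,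
      one_mul]

/-- The transfer matrix for the colors in `S`. -/
noncomputable def colorMatrix (S : Finset ℕ+) :
    Matrix S S (MvPowerSeries ℕ+ (Polynomial ℚ)) :=
  transferMatrix (MvPowerSeries.C Polynomial.X) fun i => MvPowerSeries.X (i : ℕ+)

theorem apply_mem_support_content {V : Type*} [Fintype V] (κ : V → ℕ+) (v : V) :
    κ v ∈ (content κ).support := by
  rw [Finsupp.mem_support_iff, content, Finsupp.finsetSum_apply]
  intro h
  simpa using Finset.sum_eq_zero_iff.mp h v (Finset.mem_univ v)

/-- On monomials in the variables from `S`, the chromatic quasisymmetric function of the cycle is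
the trace of a power of the transfer matrix. -/
theorem coeff_chromaticQSym_directedCycle {S : Finset ℕ+} {d : ℕ+ →₀ ℕ} (hd : d.support ⊆ S)
    (m : ℕ) :
    MvPowerSeries.coeff d (chromaticQSym (directedCycle (m + 1)))
      = MvPowerSeries.coeff d (colorMatrix S ^ (m + 1)).trace := by
  classical
  have hterm (κ : Fin (m + 1) → S) :
      MvPowerSeries.coeff d (∏ l, colorMatrix S (κ l) (κ (l + 1)))
        = if IsProper (directedCycle (m + 1)) (fun l => (κ l : ℕ+)) ∧
              content (fun l => (κ l : ℕ+)) = d then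
            (Polynomial.X : Polynomial ℚ) ^ asc (directedCycle (m + 1)) fun l => (κ l : ℕ+)
          else 0 := by
    have h1 : ∏ l, colorMatrix S (κ l) (κ (l + 1))
        = MvPowerSeries.C (∏ l, if (κ l : ℕ+) < κ (l + 1) then (Polynomial.X : Polynomial ℚ)
            else if (κ (l + 1) : ℕ+) < κ l then 1 else 0)
          * ∏ l, MvPowerSeries.X (κ l : ℕ+) := by
      -- Each matrix entry carries the variable of the head of its edge; shifting the index by one
      -- matches heads with vertices.
      rw [← Equiv.prod_comp (Equiv.addRight (1 : Fin (m + 1))) fun l => MvPowerSeries.X (κ l : ℕ+),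
        map_prod, ← prod_mul_distrib]
      refine prod_congr rfl fun l _ => ?_
      simp only [colorMatrix, transferMatrix, Matrix.of_apply, Equiv.coe_addRight,
        Subtype.coe_lt_coe]
      split_ifs <;> simp
    rw [h1, prod_ascent_weight fun l => (κ l : ℕ+), prod_X_eq_monomial,
      MvPowerSeries.coeff_C_mul, MvPowerSeries.coeff_monomial]
    by_cases hp : IsProper (directedCycle (m + 1)) fun l => (κ l : ℕ+) <;>
      simp [hp, content, eq_comm]
  rw [Matrix.trace_pow_succ_eq_sum, map_sum]
  simp only [hterm]
  rw [← sum_filter]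
  symm
  refine sum_bij (fun κ _ l => (κ l : ℕ+)) (fun κ hκ => ?_) (fun κ _ κ' _ h => ?_)
    (fun κ hκ => ?_) fun _ _ => rfl
  · simpa using hκ
  · funext l
    exact Subtype.ext (congrFun h l)
  · have hκ' : IsProper (directedCycle (m + 1)) κ ∧ content κ = d := by simpa using hκ
    refine ⟨fun l => ⟨κ l, hd (hκ'.2 ▸ apply_mem_support_content κ l)⟩, ?_, rfl⟩
    simpa using hκ'

/-- On monomials in the variables from `S`, the elementary symmetric functions agree with the
elementary symmetric polynomials in these variables. -/
theorem coeff_esymm {R : Type*} [CommRing R] {S : Finset ℕ+} {d : ℕ+ →₀ ℕ} (hd : d.support ⊆ S)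
    (k : ℕ) :
    MvPowerSeries.coeff d (esymm R k)
      = MvPowerSeries.coeff d
        (finEsymm (fun i : S => (MvPowerSeries.X (i : ℕ+) : MvPowerSeries ℕ+ R)) k) := by
  classical
  have hind (T : Finset S) (i : ℕ+) : (∑ v ∈ T, Finsupp.single (v : ℕ+) 1 : ℕ+ →₀ ℕ) i
      = if ∃ v ∈ T, (v : ℕ+) = i then 1 else 0 := by
    rw [Finsupp.finsetSum_apply]
    simp only [Finsupp.single_apply]
    split_ifs with h
    · obtain ⟨v, hv, rfl⟩ := h
      simp [hv]
    · exact sum_eq_zero fun v hv => if_neg fun hvi => h ⟨v, hv, hvi⟩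
  have hdeg (T : Finset S) :
      (∑ v ∈ T, Finsupp.single (v : ℕ+) 1 : ℕ+ →₀ ℕ).degree = #T := by
    simp [map_sum]
  rw [finEsymm, map_sum]
  simp only [prod_X_eq_monomial, MvPowerSeries.coeff_monomial]
  change (if _ then _ else _) = _
  split_ifs with h
  · obtain ⟨h1, h2⟩ := h
    -- A squarefree monomial in the variables from `S` arises from exactly one subset, its support.
    set T : Finset S := {v | (v : ℕ+) ∈ d.support} with hT
    have hTd : d = ∑ v ∈ T, Finsupp.single (v : ℕ+) 1 := by
      ext i
      rw [hind]
      split_ifs with hi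
      · obtain ⟨v, hv, rfl⟩ := hi
        have : d v ≠ 0 := by simpa [hT] using hv
        have := h2 v
        omega
      · by_contra hne
        have hmem : i ∈ d.support := Finsupp.mem_support_iff.mpr hne
        exact hi ⟨⟨i, hd hmem⟩, by simpa [hT] using hne, rfl⟩
    rw [sum_eq_single_of_mem T]
    · rw [if_pos hTd]
    · rw [mem_powersetCard_univ, ← hdeg, ← hTd, h1]
    · intro T' _ hne
      refine if_neg fun hT' => hne ?_
      ext v
      rw [hT, mem_filter, Finsupp.mem_support_iff, hT', hind]
      simp
  · symm
    refine sum_eq_zero fun T hT => if_neg fun hd' => h ⟨?_, fun i => ?_⟩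
    · rw [hd', hdeg, (mem_powersetCard.mp hT).2]
    · rw [hd', hind]
      split_ifs <;> norm_num

/-- A factorization of a monomial in the variables from `S` uses only those variables, so agreement
on such monomials passes to products. This transfers finite-variable identities to power series. -/
theorem coeff_mul_congr {R σ : Type*} [CommSemiring R] {S : Finset σ}
    {f f' g g' : MvPowerSeries σ R}
    (hf : ∀ d : σ →₀ ℕ, d.support ⊆ S → MvPowerSeries.coeff d f = MvPowerSeries.coeff d f')
    (hg : ∀ d : σ →₀ ℕ, d.support ⊆ S → MvPowerSeries.coeff d g = MvPowerSeries.coeff d g')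
    {d : σ →₀ ℕ} (hd : d.support ⊆ S) :
    MvPowerSeries.coeff d (f * g) = MvPowerSeries.coeff d (f' * g') := by
  classical
  rw [MvPowerSeries.coeff_mul, MvPowerSeries.coeff_mul]
  refine sum_congr rfl fun x hx => ?_
  have hx := mem_antidiagonal.mp hx
  rw [hf x.1 ((Finsupp.support_mono (hx ▸ le_self_add)).trans hd),
    hg x.2 ((Finsupp.support_mono (hx ▸ le_add_self)).trans hd)]

/-- The terms `t [k - 1]_t e_k`. -/
noncomputable def cycleTerm (k : ℕ) : MvPowerSeries ℕ+ (Polynomial ℚ) :=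
  MvPowerSeries.C (Polynomial.X * tInt (k - 1)) * esymm (Polynomial ℚ) k

/-- Newton-type recurrence for the chromatic quasisymmetric functions of directed cycles. -/
theorem chromaticQSym_directedCycle_succ (m : ℕ) :
    chromaticQSym (directedCycle (m + 1)) = (m + 1 : ℕ) * cycleTerm (m + 1)
      + ∑ k ∈ range m, cycleTerm (k + 1) * chromaticQSym (directedCycle (m - k)) := by
  ext1 d
  -- A single coefficient involves finitely many colors, so a finite matrix suffices.
  set S := d.support with hS
  have hX : IsLeftRegular (MvPowerSeries.C Polynomial.X - 1 : MvPowerSeries ℕ+ (Polynomial ℚ)) := by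
    intro f g h
    rw [← map_one MvPowerSeries.C, ← map_sub] at h
    ext1 d
    have hd := congrArg (MvPowerSeries.coeff d) h
    simp only [MvPowerSeries.coeff_C_mul] at hd
    refine mul_left_cancel₀ ?_ hd
    simpa using Polynomial.X_sub_C_ne_zero (1 : ℚ)
  have hD (k : ℕ) : PowerSeries.coeff (k + 1) (colorMatrix S).detOneSub
      = -(MvPowerSeries.C Polynomial.X * (∑ i ∈ range k, (MvPowerSeries.C Polynomial.X) ^ i)
        * finEsymm (fun i : S => MvPowerSeries.X (i : ℕ+)) (k + 1)) := by
    convert coeff_detOneSub_transferMatrix hX (fun i : S => MvPowerSeries.X (i : ℕ+)) k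
    rfl
  have hterm (k : ℕ) (d' : ℕ+ →₀ ℕ) (hd' : d'.support ⊆ S) :
      MvPowerSeries.coeff d' (cycleTerm (k + 1))
        = MvPowerSeries.coeff d' (-PowerSeries.coeff (k + 1) (colorMatrix S).detOneSub) := by
    rw [hD, neg_neg, cycleTerm]
    have : MvPowerSeries.C Polynomial.X * ∑ i ∈ range k, (MvPowerSeries.C Polynomial.X) ^ i
        = (MvPowerSeries.C (Polynomial.X * tInt (k + 1 - 1)) :
          MvPowerSeries ℕ+ (Polynomial ℚ)) := by
      simp [tInt, map_sum]
    rw [this]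
    exact coeff_mul_congr (fun _ _ => rfl) (fun _ h => coeff_esymm h (k + 1)) hd'
  rw [coeff_chromaticQSym_directedCycle hS.ge, Matrix.newton_detOneSub, sub_eq_add_neg, map_add,
    map_add, ← sum_neg_distrib, map_sum, map_sum]
  congr 1
  · rw [← neg_mul, mul_comm, ← Nat.cast_succ]
    exact coeff_mul_congr (fun _ _ => rfl) (fun d' h => (hterm m d' h).symm) hS.ge
  · refine sum_congr rfl fun k hk => ?_
    obtain ⟨r, hr⟩ : ∃ r, m - k = r + 1 := ⟨m - k - 1, by have := mem_range.mp hk; omega⟩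
    rw [hr, ← neg_mul]
    exact coeff_mul_congr (fun d' h => (hterm k d' h).symm)
      (fun d' h => (coeff_chromaticQSym_directedCycle h r).symm) hS.ge

end ChromaticQSym

/-! ### Symmetric unimodal polynomials -/

namespace ChromaticQSym

open Polynomial

/-- A polynomial with nonnegative coefficients that are symmetric about `m / 2` and increase up to
the middle. -/
structure IsSymmUnimodal (m : ℕ) (p : ℚ[X]) : Prop where
  natDegree_le : p.natDegree ≤ m
  reflect_eq : p.reflect m = p
  nonneg : ∀ j, 0 ≤ p.coeff j
  coeff_le_succ : ∀ j, 2 * j + 1 ≤ m → p.coeff j ≤ p.coeff (j + 1)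

namespace IsSymmUnimodal

variable {m : ℕ} {p q : ℚ[X]}

theorem coeff_tsub (h : IsSymmUnimodal m p) {j : ℕ} (hj : j ≤ m) :
    p.coeff (m - j) = p.coeff j := by
  conv_rhs => rw [← h.reflect_eq, coeff_reflect, revAt_le hj]

/-- The index `b` is at least as far from the centre `m / 2` as `a`. If `a` lies past the centre,
reflect it to `m - a ≥ b`. -/
theorem coeff_le_coeff (h : IsSymmUnimodal m p) {a b : ℕ} (hba : b ≤ a) (hab : a + b ≤ m) :
    p.coeff b ≤ p.coeff a := by
  have key : ∀ a, b ≤ a → 2 * a ≤ m + 1 → p.coeff b ≤ p.coeff a := by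
    intro a hba
    induction a, hba using Nat.le_induction with
    | base => exact fun _ => le_rfl
    | succ a _ ih => exact fun ha => (ih (by omega)).trans (h.coeff_le_succ a (by omega))
  rcases le_total (2 * a) m with ha | ha
  · exact key a hba (by omega)
  · rw [← h.coeff_tsub (show a ≤ m by omega)]
    exact key _ (by omega) (by omega)

theorem zero (m : ℕ) : IsSymmUnimodal m 0 := ⟨by simp, by simp, by simp, by simp⟩

theorem add (hp : IsSymmUnimodal m p) (hq : IsSymmUnimodal m q) : IsSymmUnimodal m (p + q) where
  natDegree_le := natDegree_add_le_of_degree_le hp.natDegree_le hq.natDegree_le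
  reflect_eq := by rw [reflect_add, hp.reflect_eq, hq.reflect_eq]
  nonneg j := by
    rw [coeff_add]
    exact add_nonneg (hp.nonneg j) (hq.nonneg j)
  coeff_le_succ j hj := by
    rw [coeff_add, coeff_add]
    exact add_le_add (hp.coeff_le_succ j hj) (hq.coeff_le_succ j hj)

theorem sum {ι : Type*} (s : Finset ι) (f : ι → ℚ[X]) (h : ∀ i ∈ s, IsSymmUnimodal m (f i)) :
    IsSymmUnimodal m (∑ i ∈ s, f i) :=
  Finset.sum_induction f _ (fun _ _ => add) (zero m) h

theorem natCast_mul (hp : IsSymmUnimodal m p) (a : ℕ) : IsSymmUnimodal m ((a : ℚ[X]) * p) := by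
  rw [← nsmul_eq_mul, ← Finset.card_range a, ← Finset.sum_const]
  exact sum _ _ fun _ _ => hp

theorem one : IsSymmUnimodal 0 1 where
  natDegree_le := by simp
  reflect_eq := by simp [reflect_one]
  nonneg j := by
    rw [coeff_one]
    split_ifs <;> norm_num
  coeff_le_succ j hj := by omega

end IsSymmUnimodal

theorem coeff_X_mul_tInt (k j : ℕ) :
    (X * tInt (k - 1)).coeff j = if 1 ≤ j ∧ j < k then 1 else 0 := by
  rcases j with _ | j
  · simp
  · rw [coeff_X_mul, tInt, finsetSum_coeff]
    simp only [coeff_X_pow, sum_ite_eq, mem_range]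
    congr 1
    exact propext ⟨fun h => by omega, fun h => by omega⟩

/-- Consecutive coefficients of the product differ by `p_j - p_{j + 1 - k}`, the second term being
absent for `j + 1 < k`. When `2 j + 1 ≤ m + k`, the two indices sum to at most `m`, so
`coeff_le_coeff` applies. -/
theorem IsSymmUnimodal.mul_tInt {m : ℕ} {p : ℚ[X]} (h : IsSymmUnimodal m p) {k : ℕ} (hk : 0 < k) :
    IsSymmUnimodal (m + k) (p * (X * tInt (k - 1))) := by
  have hdeg : (X * tInt (k - 1) : ℚ[X]).natDegree ≤ k := by
    refine natDegree_le_iff_coeff_eq_zero.mpr fun j hj => ?_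
    rw [coeff_X_mul_tInt, if_neg (by omega)]
  have hrefl : (X * tInt (k - 1) : ℚ[X]).reflect k = X * tInt (k - 1) := by
    ext j
    rw [coeff_reflect, coeff_X_mul_tInt, coeff_X_mul_tInt]
    rcases le_or_gt j k with hj | hj
    · rw [revAt_le hj]
      congr 1
      exact propext ⟨fun h => by omega, fun h => by omega⟩
    · rw [revAt_eq_self_of_lt hj]
  refine ⟨natDegree_mul_le_of_le h.natDegree_le hdeg, ?_, fun j => ?_, fun j hj => ?_⟩
  · rw [reflect_mul _ _ h.natDegree_le hdeg, hrefl, h.reflect_eq]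
  · rw [coeff_mul]
    refine sum_nonneg fun x _ => mul_nonneg (h.nonneg _) ?_
    rw [coeff_X_mul_tInt]
    split_ifs <;> norm_num
  -- The telescoping `(X - 1) X [k - 1] = X ^ k - X`, multiplied by `p`.
  · have hq : p * (X * tInt (k - 1)) * (X : ℚ[X]) = p * (X * tInt (k - 1)) - p * X + p * X ^ k := by
      have hg := geom_sum_mul (X : ℚ[X]) (k - 1)
      obtain ⟨k, rfl⟩ : ∃ r, k = r + 1 := ⟨k - 1, by omega⟩
      simp only [Nat.add_sub_cancel] at hg ⊢
      rw [tInt]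
      linear_combination p * X * hg
    have hc := congrArg (fun r : ℚ[X] => r.coeff (j + 1)) hq
    simp only [coeff_add, Polynomial.coeff_sub, coeff_mul_X, coeff_mul_X_pow'] at hc
    split_ifs at hc with hkj
    · have := h.coeff_le_coeff (a := j) (b := j + 1 - k) (by omega) (by omega)
      linarith
    · have := h.nonneg j
      linarith

theorem isSymmUnimodal_prod (l : List ℕ) (hl : ∀ i ∈ l, 0 < i) :
    IsSymmUnimodal l.sum (l.map fun k => (X : ℚ[X]) * tInt (k - 1)).prod := by
  induction l with
  | nil => exact IsSymmUnimodal.one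
  | cons k l ih =>
    rw [List.sum_cons, List.map_cons, List.prod_cons, mul_comm, add_comm]
    exact (ih fun i hi => hl i (List.mem_cons_of_mem _ hi)).mul_tInt (hl k List.mem_cons_self)

/-- The blocks sum to `n`, so all weights share the centre `n / 2` and may be added. -/
theorem isSymmUnimodal_weight {n : ℕ} (μ : Composition n) : IsSymmUnimodal n (weight μ) := by
  have h := isSymmUnimodal_prod μ.blocks fun i hi => μ.blocks_pos hi
  rw [μ.blocks_sum] at h
  exact h.natCast_mul _

end ChromaticQSym

/-! ### The `e`-expansion and its consequences -/

namespace ChromaticQSym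

/-- The `e`-expansion of the chromatic quasisymmetric function of the directed cycle. -/
theorem chromaticQSym_directedCycle_eq {n : ℕ} (hn : 0 < n) :
    chromaticQSym (directedCycle n) = ∑ p : n.Partition,
      (∑ μ : Composition n with Nat.Partition.ofComposition n μ = p, weight μ) •
        esymmPart (Polynomial ℚ) p := by
  obtain ⟨m, rfl⟩ : ∃ m, n = m + 1 := ⟨n - 1, by omega⟩
  rw [Composition.eq_sum_of_newton cycleTerm (fun k => chromaticQSym (directedCycle k))
    chromaticQSym_directedCycle_succ m,
    ← sum_fiberwise univ (Nat.Partition.ofComposition (m + 1))]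
  refine sum_congr rfl fun p _ => ?_
  rw [sum_smul]
  refine sum_congr rfl fun μ hμ => ?_
  obtain rfl := (mem_filter.mp hμ).2
  have hprod (l : List ℕ) : (l.map cycleTerm).prod
      = MvPowerSeries.C (l.map fun k => Polynomial.X * tInt (k - 1)).prod
        * (l.map (esymm (Polynomial ℚ))).prod := by
    induction l with
    | nil => simp
    | cons k l ih =>
      simp only [List.map_cons, List.prod_cons, ih, cycleTerm, map_mul]
      ring
  have hparts : esymmPart (Polynomial ℚ) (Nat.Partition.ofComposition (m + 1) μ)
      = (μ.blocks.map (esymm (Polynomial ℚ))).prod := by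
    simp [esymmPart, Nat.Partition.ofComposition]
  rw [hprod, hparts, weight, MvPowerSeries.smul_eq_C_mul, map_mul, map_natCast, mul_assoc]

theorem map_C_esymmPart {n : ℕ} (p : n.Partition) :
    MvPowerSeries.map Polynomial.C (esymmPart ℚ p) = esymmPart (Polynomial ℚ) p := by
  have h (k : ℕ) : MvPowerSeries.map Polynomial.C (esymm ℚ k) = esymm (Polynomial ℚ) k := by
    ext1 d
    rw [MvPowerSeries.coeff_map]
    classical
    change Polynomial.C (if _ then _ else _) = if _ then _ else _
    split_ifs <;> simp
  simp only [esymmPart]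
  rw [map_multiset_prod, Multiset.map_map]
  congr 2
  funext k
  exact h k

/-- The `e_p` do not involve `t`, so extracting a power of `t` affects only the weights. -/
theorem tCoeff_sum_smul_esymmPart {n : ℕ} (w : n.Partition → Polynomial ℚ) (j : ℕ) :
    tCoeff (∑ p, w p • esymmPart (Polynomial ℚ) p) j = ∑ p, (w p).coeff j • esymmPart ℚ p := by
  ext1 d
  change (MvPowerSeries.coeff d (∑ p, w p • esymmPart (Polynomial ℚ) p)).coeff j = _
  rw [map_sum, map_sum, Polynomial.finsetSum_coeff]
  refine sum_congr rfl fun p _ => ?_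
  rw [← map_C_esymmPart, MvPowerSeries.coeff_smul, MvPowerSeries.coeff_map,
    MvPowerSeries.coeff_smul, Polynomial.coeff_mul_C]

end ChromaticQSym

theorem corollary6p2 (n : ℕ) (hn : 2 ≤ n) :
    ChromaticQSym.chromaticQSym (ChromaticQSym.directedCycle n) =
        ∑ p : n.Partition,
          (∑ μ : Composition n with Nat.Partition.ofComposition n μ = p,
            ChromaticQSym.weight μ) •
            ChromaticQSym.esymmPart (Polynomial ℚ) p ∧
      ChromaticQSym.IsPalindromic (ChromaticQSym.numEdges (ChromaticQSym.directedCycle n))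
        (ChromaticQSym.chromaticQSym (ChromaticQSym.directedCycle n)) ∧
      ChromaticQSym.IsEPositiveInT n
        (ChromaticQSym.chromaticQSym (ChromaticQSym.directedCycle n)) ∧
      ChromaticQSym.IsEUnimodal n (ChromaticQSym.numEdges (ChromaticQSym.directedCycle n))
        (ChromaticQSym.chromaticQSym (ChromaticQSym.directedCycle n)) := by
  have hedges : ChromaticQSym.numEdges (ChromaticQSym.directedCycle n) = n := by
    obtain ⟨m, rfl⟩ : ∃ m, n = m + 1 := ⟨n - 1, by omega⟩
    exact ChromaticQSym.numEdges_directedCycle m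
  have hexp := ChromaticQSym.chromaticQSym_directedCycle_eq (n := n) (by omega)
  have hw (p : n.Partition) : ChromaticQSym.IsSymmUnimodal n
      (∑ μ : Composition n with Nat.Partition.ofComposition n μ = p, ChromaticQSym.weight μ) :=
    ChromaticQSym.IsSymmUnimodal.sum _ _ fun μ _ => ChromaticQSym.isSymmUnimodal_weight μ
  refine ⟨hexp, ?_⟩
  rw [hedges, hexp]
  refine ⟨⟨fun j hj => ?_, fun j hj => ?_⟩, fun j => ?_, fun j hj => ?_⟩
  · rw [ChromaticQSym.tCoeff_sum_smul_esymmPart]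
    refine Finset.sum_eq_zero fun p _ => ?_
    rw [Polynomial.coeff_eq_zero_of_natDegree_lt ((hw p).natDegree_le.trans_lt hj), zero_smul]
  · simp only [ChromaticQSym.tCoeff_sum_smul_esymmPart, (hw _).coeff_tsub hj]
  · exact ⟨_, fun p => (hw p).nonneg j, ChromaticQSym.tCoeff_sum_smul_esymmPart _ j⟩
  · have hj' : 2 * j + 1 ≤ n := by
      have : ((2 * j + 1 : ℕ) : ℚ) ≤ n := by
        push_cast
        linarith
      exact_mod_cast this
    refine ⟨_, fun p => sub_nonneg.mpr ((hw p).coeff_le_succ j hj'), ?_⟩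
    simp only [ChromaticQSym.tCoeff_sum_smul_esymmPart, sub_smul, Finset.sum_sub_distrib]
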